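/- A metric space is geodesic if any two of its points $x,y$ are joined by an isometrically embedded copy of the interval $[0,d(x,y)]$. For $L\geqslant 1$ and $C\geqslant 0$, a metric space $(X,d_X)$ is $(L,C)$-quasi-isometric to a metric space $(Y,d_Y)$ if there is a map $f:X\to Y$ such that $$\tfrac1L d_X(x_1,x_2)-C\leqslant d_Y(f(x_1),f(x_2))\leqslant L\,d_X(x_1,x_2)+C\quad\text{for all }x_1,x_2\in X,$$ and such that for every $y\in Y$ there is $x\in X$ with $d_Y(f(x),y)\leqslant C$. A simplicial tree is the geometric realization of a (non-empty) connected graph without cycles, with the path metric in which each edge is isometric to $[0,1]$; it is countable if it has at most countably many vertices, and locally finite if every vertex has only finitely many neighbours. Corollary. Let $X$ be a geodesic metric space. (1) $X$ is $(L,C)$-quasi-isometric to a countable simplicial tree for some $L\geqslant 1$, $C\geqslant 0$ if and only if $X$ is $(1,C')$-quasi-isometric to a countable simplicial tree for some $C'\geqslant 0$. (2) $X$ is $(L,C)$-quasi-isometric to a locally finite simplicial tree for some $L\geqslant 1$, $C\geqslant 0$ if and only if $X$ is $(1,C')$-quasi-isometric to a locally finite simplicial tree for some $C'\geqslant 0$.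 (The two trees in each equivalence need not be the same.) -/

import Mathlib

universe u v

/-- A metric space is geodesic if any two points `x`, `y` are joined by an isometric embedding of
the interval `[0, dist x y]`. -/
def IsGeodesicSpace (X : Type u) [MetricSpace X] : Prop :=
  ∀ x y : X, ∃ γ : ℝ → X, γ 0 = x ∧ γ (dist x y) = y ∧
    ∀ s ∈ Set.Icc 0 (dist x y), ∀ t ∈ Set.Icc 0 (dist x y), dist (γ s) (γ t) = |s - t|

/-- `f` is an `(L, C)`-quasi-isometry: coarsely bi-Lipschitz and coarsely surjective. -/
structure IsQuasiIsometry {X : Type u} {Y : Type v} [MetricSpace X] [MetricSpace Y]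
    (L C : ℝ) (f : X → Y) : Prop where
  lower : ∀ x₁ x₂ : X, 1 / L * dist x₁ x₂ - C ≤ dist (f x₁) (f x₂)
  upper : ∀ x₁ x₂ : X, dist (f x₁) (f x₂) ≤ L * dist x₁ x₂ + C
  coarsely_surjective : ∀ y : Y, ∃ x : X, dist (f x) y ≤ C

/-- `X` is `(L, C)`-quasi-isometric to `Y`. -/
def QuasiIsometricTo (L C : ℝ) (X : Type u) (Y : Type v) [MetricSpace X] [MetricSpace Y] : Prop :=
  ∃ f : X → Y, IsQuasiIsometry L C f

/-- A (combinatorial) simplicial tree: a connected graph without cycles, regarded as a simplicial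
complex whose simplices are its vertices and its edges. The associated metric space is
`SimplicialTree.Space`. -/
structure SimplicialTree where
  /-- the vertices -/
  V : Type v
  /-- the edges -/
  graph : SimpleGraph V
  isTree : graph.IsTree

namespace SimplicialTree

/-- Countably many (possibly only finitely many) vertices. -/
def IsCountable (T : SimplicialTree.{v}) : Prop := Countable T.V

/-- Every vertex has only finitely many neighbours. -/
def IsLocallyFinite (T : SimplicialTree.{v}) : Prop := ∀ a : T.V, (T.graph.neighborSet a).Finite

/-- The geometric realization in barycentric coordinates: convex combinations of vertices whose
support is a vertex or the pair of endpoints of an edge. -/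
@[ext]
structure Space (T : SimplicialTree.{v}) where
  coord : T.V →₀ ℝ
  nonneg : ∀ a, 0 ≤ coord a
  sum_eq_one : (coord.sum fun _ t => t) = 1
  support_simplex : (∃ a, (coord.support : Set T.V) = {a}) ∨
    ∃ a b, T.graph.Adj a b ∧ (coord.support : Set T.V) = {a, b}

variable {T : SimplicialTree.{v}}

/-- `Chain p q ℓ`: there is a finite sequence of points `p = x₀, x₁, …, xₙ = q` with `xᵢ`, `xᵢ₊₁`
on a common closed edge for each `i`, of total length `ℓ`. The closed edge with endpoints `a`, `b`
is identified with `[0, 1]` by the barycentric coordinate at `a`, so two of its points `p`, `q` are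
at distance `|p a - q a|` (which equals `|p b - q b|`). -/
inductive Chain : T.Space → T.Space → ℝ → Prop
  | nil (p : T.Space) : Chain p p 0
  | cons {p q r : T.Space} {ℓ : ℝ} (a b : T.V) (hab : T.graph.Adj a b)
      (hp : (p.coord.support : Set T.V) ⊆ {a, b}) (hq : (q.coord.support : Set T.V) ⊆ {a, b})
      (h : Chain q r ℓ) : Chain p r (|p.coord a - q.coord a| + ℓ)

theorem coord_add_of_subset (p : T.Space) {a b : T.V} (hab : a ≠ b)
    (hp : (p.coord.support : Set T.V) ⊆ {a, b}) : p.coord a + p.coord b = 1 := by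
  classical
  have h := p.sum_eq_one
  rw [Finsupp.sum_of_support_subset (s := {a, b}) _ (by
    intro x hx; simpa using hp (Finset.mem_coe.2 hx)) _ (by simp)] at h
  rwa [Finset.sum_pair hab] at h

theorem Chain.trans {p q r : T.Space} {ℓ m : ℝ} (h : Chain p q ℓ) (h' : Chain q r m) :
    Chain p r (ℓ + m) := by
  induction h with
  | nil p => simpa using h'
  | cons a b hab hp hq _ ih => rw [add_assoc]; exact Chain.cons a b hab hp hq (ih h')

theorem Chain.symm {p q : T.Space} {ℓ : ℝ} (h : Chain p q ℓ) : Chain q p ℓ := by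
  induction h with
  | nil p => exact Chain.nil p
  | @cons p q r ℓ a b hab hp hq _ ih =>
    have h1 : Chain q p |p.coord a - q.coord a| := by
      simpa [abs_sub_comm] using Chain.cons a b hab hq hp (Chain.nil p)
    simpa [add_comm] using ih.trans h1

/-- Barycentric coordinates do not vary by more than the length of a chain. -/
theorem Chain.abs_coord_sub_le {p q : T.Space} {ℓ : ℝ} (h : Chain p q ℓ) (c : T.V) :
    |p.coord c - q.coord c| ≤ ℓ := by
  induction h with
  | nil p => simp
  | @cons p q r ℓ a b hab hp hq _ ih =>
    have h1 : |p.coord c - q.coord c| ≤ |p.coord a - q.coord a| := by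
      have e1 := coord_add_of_subset p hab.ne hp
      have e2 := coord_add_of_subset q hab.ne hq
      by_cases hca : c = a
      · rw [hca]
      by_cases hcb : c = b
      · have : p.coord c - q.coord c = -(p.coord a - q.coord a) := by rw [hcb]; linarith
        rw [this, abs_neg]
      · have z1 : p.coord c = 0 := by
          by_contra hne
          have := hp (Finset.mem_coe.2 (Finsupp.mem_support_iff.2 hne))
          simp [hca, hcb] at this
        have z2 : q.coord c = 0 := by
          by_contra hne
          have := hq (Finset.mem_coe.2 (Finsupp.mem_support_iff.2 hne))
          simp [hca, hcb] at this
        simp [z1, z2]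
    calc |p.coord c - r.coord c| ≤ |p.coord c - q.coord c| + |q.coord c - r.coord c| :=
          abs_sub_le _ _ _
      _ ≤ _ := add_le_add h1 ih

/-- The point of the realization given by a vertex. -/
noncomputable def vertex (T : SimplicialTree.{v}) (a : T.V) : T.Space where
  coord := Finsupp.single a 1
  nonneg := by
    classical
    intro b
    rw [Finsupp.single_apply]
    split_ifs <;> norm_num
  sum_eq_one := by simp
  support_simplex := by
    classical
    left
    exact ⟨a, by rw [Finsupp.support_single _ one_ne_zero]; simp⟩

theorem vertex_support (a : T.V) : ((T.vertex a).coord.support : Set T.V) = {a} := by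
  classical
  simp [vertex, Finsupp.support_single]

theorem exists_chain_vertex (p : T.Space) : ∃ a ℓ, Chain p (T.vertex a) ℓ := by
  classical
  rcases p.support_simplex with ⟨a, ha⟩ | ⟨a, b, hab, h⟩
  · refine ⟨a, 0, ?_⟩
    have hs : p.coord.support = {a} := by exact_mod_cast ha
    have h1 := p.sum_eq_one
    rw [Finsupp.sum, hs, Finset.sum_singleton] at h1
    have : p = T.vertex a := by
      ext c
      by_cases hc : c = a
      · simp [hc, vertex, h1]
      · have : c ∉ p.coord.support := by rw [hs]; simpa using hc
        rw [Finsupp.notMem_support_iff.1 this]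
        simp [vertex, Ne.symm hc]
    rw [this]
    exact Chain.nil _
  · exact ⟨a, _, Chain.cons a b hab h.le (by rw [vertex_support]; simp) (Chain.nil _)⟩

theorem exists_chain_of_walk {a b : T.V} (w : T.graph.Walk a b) :
    ∃ ℓ, Chain (T.vertex a) (T.vertex b) ℓ := by
  induction w with
  | nil => exact ⟨0, Chain.nil _⟩
  | @cons a b c h _ ih =>
    obtain ⟨ℓ, hℓ⟩ := ih
    exact ⟨_, Chain.cons a b h (by rw [vertex_support]; simp) (by rw [vertex_support]; simp) hℓ⟩

theorem exists_chain (p q : T.Space) : ∃ ℓ, Chain p q ℓ := by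
  obtain ⟨a, ℓ, ha⟩ := exists_chain_vertex p
  obtain ⟨b, m, hb⟩ := exists_chain_vertex q
  obtain ⟨w⟩ := T.isTree.connected.preconnected a b
  obtain ⟨n, hn⟩ := exists_chain_of_walk w
  exact ⟨_, (ha.trans hn).trans hb.symm⟩

theorem Chain.nonneg {p q : T.Space} {ℓ : ℝ} (h : Chain p q ℓ) : 0 ≤ ℓ := by
  induction h with
  | nil p => exact le_rfl
  | cons _ _ _ _ _ _ ih => exact add_nonneg (abs_nonneg _) ih

/-- The path distance: the infimum of the lengths of chains. -/
noncomputable def pathDist (p q : T.Space) : ℝ := sInf {ℓ | Chain p q ℓ}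

theorem pathDist_le {p q : T.Space} {ℓ : ℝ} (h : Chain p q ℓ) : pathDist p q ≤ ℓ :=
  csInf_le ⟨0, fun _ h' => h'.nonneg⟩ h

theorem le_pathDist {p q : T.Space} {m : ℝ} (h : ∀ ℓ, Chain p q ℓ → m ≤ ℓ) : m ≤ pathDist p q :=
  le_csInf (exists_chain p q) h

/-- The path metric on the realization of a simplicial tree, every edge having length `1`. -/
noncomputable instance (T : SimplicialTree.{v}) : MetricSpace T.Space where
  dist := pathDist
  dist_self p := le_antisymm (pathDist_le (Chain.nil p)) (le_pathDist fun _ h => h.nonneg)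
  dist_comm p q := le_antisymm (le_pathDist fun _ h => pathDist_le h.symm)
    (le_pathDist fun _ h => pathDist_le h.symm)
  dist_triangle p q r := by
    have h1 : ∀ ℓ, Chain p q ℓ → pathDist p r - ℓ ≤ pathDist q r := fun ℓ h =>
      le_pathDist fun m h' => by linarith [pathDist_le (h.trans h')]
    have h2 : pathDist p r - pathDist q r ≤ pathDist p q :=
      le_pathDist fun ℓ h => by linarith [h1 ℓ h]
    linarith
  eq_of_dist_eq_zero {p q} h := by
    ext c
    have h1 : |p.coord c - q.coord c| ≤ pathDist p q := le_pathDist fun _ h => h.abs_coord_sub_le c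
    have h2 : |p.coord c - q.coord c| ≤ 0 := h1.trans h.le
    exact sub_eq_zero.1 (abs_nonpos_iff.1 h2)

end SimplicialTree

/-! ### Walks in trees, and trees given by a parent map. -/

namespace SimpleGraph

variable {V : Type v} {G : SimpleGraph V}

/-! Only the passage from multiplicative constant `L` to `1` needs an argument. Fix a basepoint `o`.
The coarse components (clusters) of the complements of open balls of integer radius around `o` form
a rooted tree under inclusion. Send `x` to its cluster at level `⌊d(o,x)⌋`. Geodesics towards `o`
drop one level per unit length, so this map distorts distances only additively as soon as two points
of a common level-`k` cluster, both on the sphere of radius `k`, are uniformly close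
(`quasiIsometricTo_tree`).

The original tree provides that closeness (`exists_cluster_bound`). By `exists_coarse_median`, a
chain from `x` to `y` outside the ball has a point `z` near both a geodesic `[x,o]` and a geodesic
`[y,o]`. As `z` is no closer to `o` than `x` and `y` are, it must be near both of them.

Finally, a cluster is determined by its level and one vertex of the original tree, which transfers
countability and local finiteness (`exists_tree`). -/

theorem dist_le_length_of_mem_support {a b m : V} (w : G.Walk a b) (hm : m ∈ w.support) :
    G.dist a m ≤ w.length := by
  classical
  exact (dist_le (w.takeUntil m hm)).trans (w.length_takeUntil_le_length hm)

theorem Walk.exists_switch {a b : V} (w : G.Walk a b) (A B : V → Prop)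
    (hAB : ∀ m ∈ w.support, A m ∨ B m) (ha : A a) (hb : B b) :
    ∃ s t, s ∈ w.support ∧ A s ∧ B t ∧ G.dist s t ≤ 1 := by
  induction w with
  | nil => exact ⟨_, _, by simp, ha, hb, by simp⟩
  | @cons a c b h w ih =>
    by_cases hc : A c
    · obtain ⟨s, t, hs, hA, hB, hd⟩ := ih (fun m hm => hAB m (by simp [hm])) hc hb
      exact ⟨s, t, by simp [hs], hA, hB, hd⟩
    · exact ⟨a, c, by simp, ha, (hAB c (by simp)).resolve_left hc, (dist_eq_one_iff_adj.2 h).le⟩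

theorem IsTree.support_path_subset (hG : G.IsTree) {a b : V} (p : G.Walk a b) (hp : p.IsPath)
    (w : G.Walk a b) : p.support ⊆ w.support := by
  classical
  have : p = w.bypass := (hG.existsUnique_path a b).unique hp w.bypass_isPath
  rw [this]
  exact w.support_bypass_subset_support

/-- Coarse medians: three walks joining three vertices of a tree in pairs nearly meet. -/
theorem IsTree.exists_coarse_median (hG : G.IsTree) {a b c : V} (w₁ : G.Walk a b)
    (w₂ : G.Walk a c) (w₃ : G.Walk b c) :
    ∃ s t, s ∈ w₁.support ∧ s ∈ w₂.support ∧ t ∈ w₃.support ∧ G.dist s t ≤ 1 := by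
  obtain ⟨p, hp, -⟩ := hG.existsUnique_path a b
  -- The path from `a` to `b` lies in every walk between them, in particular in `w₂` followed by
  -- `w₃` reversed, so somewhere it switches from one to the other.
  obtain ⟨s, t, hs, h2, h3, hd⟩ := p.exists_switch (· ∈ w₂.support) (· ∈ w₃.support)
    (fun m hm => by simpa using hG.support_path_subset p hp (w₂.append w₃.reverse) hm)
    (by simp) (by simp)
  exact ⟨s, t, hG.support_path_subset p hp w₁ hs, h2, h3, hd⟩

/-- A chain of points whose images make bounded jumps in a connected graph is shadowed by a
walk. -/
theorem Connected.exists_walk_near_chain (hG : G.Connected) {X : Type u} (g : X → V)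
    {R : X → X → Prop} {E : ℕ} (hR : ∀ x y, R x y → G.dist (g x) (g y) ≤ E) {x y : X}
    (h : Relation.ReflTransGen R x y) :
    ∃ w : G.Walk (g x) (g y), ∀ m ∈ w.support,
      ∃ z, Relation.ReflTransGen R x z ∧ G.dist (g z) m ≤ E := by
  induction h with
  | refl => exact ⟨Walk.nil, fun m hm => ⟨x, .refl, by simp_all⟩⟩
  | @tail y z hxy hyz ih =>
    obtain ⟨w, hw⟩ := ih
    obtain ⟨w', hw'⟩ := hG.exists_walk_length_eq_dist (g y) (g z)
    refine ⟨w.append w', fun m hm => ?_⟩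
    rw [Walk.mem_support_append_iff] at hm
    rcases hm with hm | hm
    · exact hw m hm
    · exact ⟨y, hxy, (dist_le_length_of_mem_support w' hm).trans (hw'.trans_le (hR y z hyz))⟩

theorem Connected.finite_ball (hG : G.Connected) (hf : ∀ a, (G.neighborSet a).Finite) (a : V)
    (n : ℕ) : {b | G.dist a b ≤ n}.Finite := by
  induction n with
  | zero =>
    refine (Set.finite_singleton a).subset fun b hb => ?_
    simpa [hG.dist_eq_zero_iff, eq_comm] using hb
  | succ n ih =>
    refine (ih.union (ih.biUnion fun b _ => hf b)).subset fun b hb => ?_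
    obtain ⟨w, hw⟩ := hG.exists_walk_length_eq_dist b a
    cases w with
    | nil => left; simp
    | @cons _ c _ h w =>
      right
      simp only [Set.mem_iUnion, mem_neighborSet]
      refine ⟨c, ?_, h.symm⟩
      have h1 := dist_le w
      rw [Walk.length_cons, dist_comm] at hw
      simp only [Set.mem_ofPred_eq] at hb ⊢
      rw [dist_comm]
      omega

/-- The graph joining every vertex to its parent. -/
def parentGraph (par : V → V) : SimpleGraph V := fromRel fun a b => par a = b

theorem parentGraph_adj {par : V → V} {a b : V} :
    (parentGraph par).Adj a b ↔ a ≠ b ∧ (par a = b ∨ par b = a) := by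
  simp [parentGraph, fromRel_adj]

theorem parentGraph_dist_le_one {par : V → V} {a b : V} (h : par a = b) :
    (parentGraph par).dist a b ≤ 1 := by
  by_cases hab : a = b
  · simp [hab]
  · exact (dist_eq_one_iff_adj.2 (parentGraph_adj.2 ⟨hab, .inl h⟩)).le

/-- The endpoints of a walk have a common ancestor within the length of the walk. -/
theorem exists_iterate_eq_of_parentGraph_walk {par : V → V} {a b : V}
    (w : (parentGraph par).Walk a b) : ∃ i j, par^[i] a = par^[j] b ∧ i + j ≤ w.length := by
  induction w with
  | nil => exact ⟨0, 0, rfl, by simp⟩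
  | @cons a c b h w ih =>
    obtain ⟨i, j, hij, hl⟩ := ih
    rw [Walk.length_cons]
    rcases (parentGraph_adj.1 h).2 with h | h
    · exact ⟨i + 1, j, by rw [Function.iterate_succ_apply, h, hij], by omega⟩
    · cases i with
      | zero =>
        refine ⟨0, j + 1, ?_, by omega⟩
        rw [Function.iterate_succ_apply', ← hij]
        simp [h]
      | succ i => exact ⟨i, j, by rw [← hij, Function.iterate_succ_apply, h], by omega⟩

/-- Following parents lowers the level until `r`, which gives connectedness. Every edge is a bridge:
without the edge from `a` to its parent, a walk cannot leave the descendants of `a`, and the parent,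
being of lower level, is not one of them. Truncated subtraction makes `r` its own parent, a loop
that `fromRel` discards. -/
theorem parentGraph_isTree {par : V → V} (lev : V → ℕ) (r : V) (hr : ∀ a, lev a = 0 ↔ a = r)
    (hpar : ∀ a, lev (par a) = lev a - 1) : (parentGraph par).IsTree := by
  have hreach : ∀ n a, lev a = n → (parentGraph par).Reachable a r := by
    intro n
    induction n with
    | zero => intro a ha; rw [(hr a).1 ha]
    | succ n ih =>
      intro a ha
      have h1 : lev (par a) = n := by rw [hpar, ha]; rfl
      refine (Adj.reachable (parentGraph_adj.2 ⟨?_, .inl rfl⟩)).trans (ih _ h1)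
      intro h
      rw [← h] at h1
      omega
  have hlev : ∀ n a, lev (par^[n] a) ≤ lev a := by
    intro n
    induction n with
    | zero => simp
    | succ n ih => intro a; rw [Function.iterate_succ_apply', hpar]; have := ih a; omega
  have key : ∀ a, par a ≠ a → (parentGraph par).IsBridge s(a, par a) := by
    intro a ha
    rw [isBridge_iff]
    rintro ⟨w⟩
    have hpos : lev a ≠ 0 := by
      intro h0
      have h1 : par a = r := (hr _).1 (by rw [hpar, h0])
      exact ha (by rw [h1, (hr a).1 h0])
    have hdesc : ∀ {c d : V} (w : ((parentGraph par).deleteEdges {s(a, par a)}).Walk c d),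
        (∃ n, par^[n] c = a) → ∃ n, par^[n] d = a := by
      intro c d w
      induction w with
      | nil => exact id
      | @cons c d e h w ih =>
        rintro ⟨n, hn⟩
        apply ih
        rw [deleteEdges_adj, parentGraph_adj] at h
        obtain ⟨⟨-, h | h⟩, h'⟩ := h
        · cases n with
          | zero =>
            have hn : c = a := hn
            subst hn
            exact absurd (by simp [h]) h'
          | succ n => exact ⟨n, by rw [← hn, Function.iterate_succ_apply, h]⟩
        · exact ⟨n + 1, by rw [Function.iterate_succ_apply, h, hn]⟩
    obtain ⟨n, hn⟩ := hdesc w ⟨0, rfl⟩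
    have h1 := hlev n (par a)
    rw [hn, hpar] at h1
    omega
  refine ⟨?_, isAcyclic_iff_forall_isBridge.2 ?_⟩
  · have : Nonempty V := ⟨r⟩
    exact ⟨fun a b => (hreach _ a rfl).trans (hreach _ b rfl).symm⟩
  · intro e
    induction e with
    | _ a b =>
      intro h
      obtain ⟨hne, h | h⟩ := parentGraph_adj.1 ((mem_edgeSet _).1 h)
      · subst h; exact key a (Ne.symm hne)
      · subst h; rw [Sym2.eq_swap]; exact key b hne

end SimpleGraph

/-! ### Distances between vertices in the realization. -/

namespace SimplicialTree

variable {T : SimplicialTree.{v}}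

theorem exists_dist_vertex_le_one (p : T.Space) : ∃ a, dist p (T.vertex a) ≤ 1 := by
  classical
  rcases p.support_simplex with ⟨a, ha⟩ | ⟨a, b, hab, h⟩
  · refine ⟨a, ?_⟩
    have hs : p.coord.support = {a} := by exact_mod_cast ha
    have h1 := p.sum_eq_one
    rw [Finsupp.sum, hs, Finset.sum_singleton] at h1
    have : p = T.vertex a := by
      ext c
      by_cases hc : c = a
      · simp [hc, vertex, h1]
      · have : c ∉ p.coord.support := by rw [hs]; simpa using hc
        rw [Finsupp.notMem_support_iff.1 this]
        simp [vertex, Ne.symm hc]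
    rw [this, dist_self]
    exact zero_le_one
  · refine ⟨a, (pathDist_le (Chain.cons a b hab h.le (by rw [vertex_support]; simp)
      (Chain.nil _))).trans ?_⟩
    have h1 := coord_add_of_subset p hab.ne h.le
    have h2 := p.nonneg a
    have h3 := p.nonneg b
    have h4 : (T.vertex a).coord a = 1 := by simp [vertex]
    rw [h4, add_zero, abs_le]
    constructor <;> linarith

theorem dist_vertex_le_length {a b : T.V} (w : T.graph.Walk a b) :
    dist (T.vertex a) (T.vertex b) ≤ w.length := by
  classical
  induction w with
  | nil => simp
  | @cons a b c h w ih =>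
    have h1 : dist (T.vertex a) (T.vertex b) ≤ 1 := by
      refine (pathDist_le (Chain.cons a b h (by rw [vertex_support]; simp)
        (by rw [vertex_support]; simp) (Chain.nil _))).trans ?_
      simp [vertex, h.ne']
    have := dist_triangle (T.vertex a) (T.vertex b) (T.vertex c)
    rw [SimpleGraph.Walk.length_cons]
    push_cast
    linarith

/-- The affine extension of `φ` is 1-Lipschitz on each edge. With `φ` the graph distance to a
vertex, this bounds chain lengths from below in `dist_vertex`. -/
theorem Chain.abs_sub_le_of_affine {p q : T.Space} {ℓ : ℝ} (h : Chain p q ℓ) (φ : T.V → ℝ)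
    (hφ : ∀ a b, T.graph.Adj a b → |φ a - φ b| ≤ 1) :
    |(p.coord.sum fun a t => t * φ a) - q.coord.sum fun a t => t * φ a| ≤ ℓ := by
  classical
  induction h with
  | nil p => simp
  | @cons p q r ℓ a b hab hp hq _ ih =>
    have key : ∀ s : T.Space, (s.coord.support : Set T.V) ⊆ {a, b} →
        (s.coord.sum fun a t => t * φ a) = s.coord a * φ a + (1 - s.coord a) * φ b := by
      intro s hs
      rw [Finsupp.sum_of_support_subset (s := {a, b}) _ (by
        intro x hx; simpa using hs (Finset.mem_coe.2 hx)) _ (by simp), Finset.sum_pair hab.ne,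
        ← coord_add_of_subset s hab.ne hs]
      ring
    have h1 : |(p.coord.sum fun a t => t * φ a) - q.coord.sum fun a t => t * φ a| ≤
        |p.coord a - q.coord a| := by
      rw [key p hp, key q hq]
      have : p.coord a * φ a + (1 - p.coord a) * φ b - (q.coord a * φ a + (1 - q.coord a) * φ b)
          = (p.coord a - q.coord a) * (φ a - φ b) := by ring
      rw [this, abs_mul]
      exact mul_le_of_le_one_right (abs_nonneg _) (hφ a b hab)
    exact (abs_sub_le _ _ _).trans (add_le_add h1 ih)

theorem dist_vertex (a b : T.V) : dist (T.vertex a) (T.vertex b) = T.graph.dist a b := by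
  apply le_antisymm
  · obtain ⟨w, hw⟩ := T.isTree.connected.exists_walk_length_eq_dist a b
    rw [← hw]
    exact dist_vertex_le_length w
  · refine le_pathDist fun ℓ h => ?_
    have := h.abs_sub_le_of_affine (fun c => (T.graph.dist c b : ℝ)) (by
      intro c d hcd
      have h1 := SimpleGraph.dist_eq_one_iff_adj.2 hcd
      have h2 := T.isTree.connected.dist_triangle (u := c) (v := d) (w := b)
      have h3 := T.isTree.connected.dist_triangle (u := d) (v := c) (w := b)
      rw [SimpleGraph.dist_comm (u := d) (v := c)] at h3
      rw [h1] at h2 h3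
      have h2' : (T.graph.dist c b : ℝ) ≤ 1 + T.graph.dist d b := by exact_mod_cast h2
      have h3' : (T.graph.dist d b : ℝ) ≤ 1 + T.graph.dist c b := by exact_mod_cast h3
      rw [abs_le]
      constructor <;> linarith)
    simpa [vertex] using this

end SimplicialTree
-- Discrete chains along geodesics.
section Geodesic

variable {X : Type u} [MetricSpace X]

theorem IsGeodesicSpace.exists_between (hX : IsGeodesicSpace X) (x y : X) {t : ℝ} (h0 : 0 ≤ t)
    (h1 : t ≤ dist x y) : ∃ z, dist x z = t ∧ dist z y = dist x y - t := by
  obtain ⟨γ, hx, hy, hγ⟩ := hX x y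
  refine ⟨γ t, ?_, ?_⟩
  · have := hγ 0 ⟨le_rfl, dist_nonneg⟩ t ⟨h0, h1⟩
    rwa [hx, zero_sub, abs_neg, abs_of_nonneg h0] at this
  · have := hγ t ⟨h0, h1⟩ (dist x y) ⟨dist_nonneg, le_rfl⟩
    rwa [hy, abs_sub_comm, abs_of_nonneg (sub_nonneg.2 h1)] at this

theorem IsGeodesicSpace.exists_chain (hX : IsGeodesicSpace X) (x y : X) :
    ∃ p : ℕ → X, p 0 = x ∧ p ⌈dist x y⌉₊ = y ∧ (∀ i, dist (p i) (p (i + 1)) ≤ 1) ∧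
      ∀ i, dist x (p i) + dist (p i) y = dist x y := by
  obtain ⟨γ, hx, hy, hγ⟩ := hX x y
  have hmem : ∀ i : ℕ, min (i : ℝ) (dist x y) ∈ Set.Icc 0 (dist x y) := fun i =>
    ⟨le_min i.cast_nonneg dist_nonneg, min_le_right _ _⟩
  -- Clamping the parameter makes the chain stay at `y` once it arrives, so the bounds hold at every
  -- index.
  refine ⟨fun i => γ (min i (dist x y)), by simp [hx], by simp [Nat.le_ceil, hy], fun i => ?_,
    fun i => ?_⟩
  · rw [hγ _ (hmem i) _ (hmem (i + 1))]
    refine (abs_min_sub_min_le_max _ _ _ _).trans ?_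
    simp
  · have h1 := hγ 0 ⟨le_rfl, dist_nonneg⟩ _ (hmem i)
    have h2 := hγ _ (hmem i) (dist x y) ⟨dist_nonneg, le_rfl⟩
    rw [hx, zero_sub, abs_neg, abs_of_nonneg (hmem i).1] at h1
    rw [hy, abs_sub_comm, abs_of_nonneg (sub_nonneg.2 (hmem i).2)] at h2
    simp only [h1, h2]
    ring

/-- Any two points are joined by a chain of unit jumps along a geodesic. -/
theorem IsGeodesicSpace.reflTransGen (hX : IsGeodesicSpace X) (x y : X) :
    Relation.ReflTransGen (fun a b => dist a b ≤ 1 ∧ dist x a + dist a y = dist x y ∧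
      dist x b + dist b y = dist x y) x y := by
  obtain ⟨p, h0, h1, h, hp⟩ := hX.exists_chain x y
  have : ∀ i, Relation.ReflTransGen (fun a b => dist a b ≤ 1 ∧ dist x a + dist a y = dist x y ∧
      dist x b + dist b y = dist x y) x (p i) := by
    intro i
    induction i with
    | zero => rw [h0]
    | succ i ih => exact ih.tail ⟨h i, hp i, hp (i + 1)⟩
  simpa [h1] using this ⌈dist x y⌉₊

end Geodesic

/-! ### The tree of clusters. -/

section Cluster

variable {X : Type u} [MetricSpace X]

/-- A jump of length at most `J` outside the open ball of radius `k` around `o`. -/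
def OuterJump (o : X) (J : ℝ) (k : ℕ) (x y : X) : Prop :=
  (k : ℝ) ≤ dist o x ∧ (k : ℝ) ≤ dist o y ∧ dist x y ≤ J

theorem OuterJump.symm {o : X} {J : ℝ} {k : ℕ} {x y : X} (h : OuterJump o J k x y) :
    OuterJump o J k y x :=
  ⟨h.2.1, h.1, by rw [dist_comm]; exact h.2.2⟩

theorem OuterJump.mono {o : X} {J : ℝ} {k l : ℕ} (hkl : l ≤ k) {x y : X}
    (h : OuterJump o J k x y) : OuterJump o J l x y :=
  ⟨(Nat.cast_le.2 hkl).trans h.1, (Nat.cast_le.2 hkl).trans h.2.1, h.2.2⟩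

theorem OuterJump.reflTransGen_symm {o : X} {J : ℝ} {k : ℕ} {x y : X}
    (h : Relation.ReflTransGen (OuterJump o J k) x y) :
    Relation.ReflTransGen (OuterJump o J k) y x := by
  have : Std.Symm (OuterJump o J k) := ⟨fun _ _ => OuterJump.symm⟩
  exact Std.Symm.symm _ _ h

theorem OuterJump.le_of_reflTransGen {o : X} {J : ℝ} {k : ℕ} {x y : X} (hx : (k : ℝ) ≤ dist o x)
    (h : Relation.ReflTransGen (OuterJump o J k) x y) : (k : ℝ) ≤ dist o y := by
  cases h with
  | refl => exact hx
  | tail _ h => exact h.2.1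

/-- Points at level `k`, up to chains of jumps outside the ball of radius `k`. -/
def clusterSetoid (o : X) (J : ℝ) : Setoid {p : ℕ × X // (p.1 : ℝ) ≤ dist o p.2} where
  r p q := p.1.1 = q.1.1 ∧ Relation.ReflTransGen (OuterJump o J p.1.1) p.1.2 q.1.2
  iseqv :=
    { refl := fun _ => ⟨rfl, .refl⟩
      symm := fun h => ⟨h.1.symm, h.1 ▸ OuterJump.reflTransGen_symm h.2⟩
      trans := fun h h' => ⟨h.1.trans h'.1, h.2.trans (h.1 ▸ h'.2)⟩ }

/-- The coarse connected components of the complements of balls around `o`. -/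
def Cluster (o : X) (J : ℝ) : Type u := Quotient (clusterSetoid o J)

namespace Cluster

variable {o : X} {J : ℝ}

/-- The cluster of `x` at level `k`. -/
def mk (J : ℝ) (k : ℕ) (x : X) (h : (k : ℝ) ≤ dist o x) : Cluster o J :=
  Quotient.mk (clusterSetoid o J) ⟨(k, x), h⟩

theorem mk_eq_mk {k l : ℕ} {x y : X} {h : (k : ℝ) ≤ dist o x} {h' : (l : ℝ) ≤ dist o y} :
    mk J k x h = mk J l y h' ↔ k = l ∧ Relation.ReflTransGen (OuterJump o J k) x y :=
  Quotient.eq (r := clusterSetoid o J)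

theorem exists_eq_mk (c : Cluster o J) : ∃ k x h, c = mk J k x h := by
  induction c using Quotient.ind with
  | _ p => exact ⟨p.1.1, p.1.2, p.2, rfl⟩

/-- The level of a cluster. -/
def level (c : Cluster o J) : ℕ := Quotient.lift (fun p => p.1.1)
  (fun p q (h : (clusterSetoid o J).r p q) => h.1) c

theorem cast_sub_le {k : ℕ} {x : X} (h : (k : ℝ) ≤ dist o x) (i : ℕ) :
    ((k - i : ℕ) : ℝ) ≤ dist o x :=
  (Nat.cast_le.2 (Nat.sub_le k i)).trans h

/-- The cluster one level below. -/
def parent (c : Cluster o J) : Cluster o J :=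
  Quotient.lift (fun p => mk J (p.1.1 - 1) p.1.2 (cast_sub_le p.2 1))
    (fun p q (h : (clusterSetoid o J).r p q) => mk_eq_mk.2 ⟨by rw [h.1],
      h.2.lift id fun _ _ => OuterJump.mono (Nat.sub_le _ _)⟩) c

theorem parent_mk {k : ℕ} {x : X} (h : (k : ℝ) ≤ dist o x) :
    (mk J k x h).parent = mk J (k - 1) x (cast_sub_le h 1) := rfl

theorem iterate_parent_mk {k : ℕ} {x : X} (h : (k : ℝ) ≤ dist o x) (i : ℕ) :
    parent^[i] (mk J k x h) = mk J (k - i) x (cast_sub_le h i) := by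
  induction i with
  | zero => rfl
  | succ i ih => rw [Function.iterate_succ_apply', ih, parent_mk]; rfl

theorem level_parent (c : Cluster o J) : c.parent.level = c.level - 1 := by
  obtain ⟨k, x, h, rfl⟩ := c.exists_eq_mk
  rfl

/-- The cluster of `x` at its highest possible level. -/
noncomputable def of (o : X) (J : ℝ) (x : X) : Cluster o J :=
  mk J ⌊dist o x⌋₊ x (Nat.floor_le dist_nonneg)

/-- The cluster of `o`. -/
def root (o : X) (J : ℝ) : Cluster o J := mk J 0 o (by simp)

/-- Move from `x` towards `o` and stop on the sphere of radius `k`: by the triangle inequality no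
point on the way is closer to `o` than `k`. -/
theorem reflTransGen_of_geodesic (hX : IsGeodesicSpace X) (hJ : 1 ≤ J) {k : ℕ} {x : X}
    (h : (k : ℝ) ≤ dist o x) :
    ∃ z, dist o z = k ∧ dist x z = dist o x - k ∧
      Relation.ReflTransGen (OuterJump o J k) x z := by
  obtain ⟨z, hz1, hz2⟩ := hX.exists_between o x k.cast_nonneg h
  rw [dist_comm] at hz2
  refine ⟨z, hz1, hz2, (hX.reflTransGen x z).lift id ?_⟩
  have key : ∀ a, dist x a + dist a z = dist x z → (k : ℝ) ≤ dist o a := by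
    intro a ha
    have h1 := dist_triangle o a x
    rw [dist_comm a x] at h1
    have h2 := dist_nonneg (x := a) (y := z)
    linarith
  exact fun a b hab => ⟨key a hab.2.1, key b hab.2.2, hab.1.trans hJ⟩

theorem level_eq_zero (hX : IsGeodesicSpace X) (hJ : 1 ≤ J) (c : Cluster o J) :
    c.level = 0 ↔ c = root o J := by
  refine ⟨fun hc => ?_, fun hc => by rw [hc]; rfl⟩
  obtain ⟨k, x, h, rfl⟩ := c.exists_eq_mk
  obtain rfl : k = 0 := hc
  obtain ⟨z, hz, -, hxz⟩ := reflTransGen_of_geodesic hX hJ h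
  obtain rfl : o = z := dist_eq_zero.1 (by simpa using hz)
  exact mk_eq_mk.2 ⟨rfl, hxz⟩

theorem exists_eq_mk_level (hX : IsGeodesicSpace X) (hJ : 1 ≤ J) (c : Cluster o J) :
    ∃ x, ∃ h : dist o x = c.level, c = mk J c.level x h.ge := by
  obtain ⟨k, x, h, rfl⟩ := c.exists_eq_mk
  obtain ⟨z, hz, -, hxz⟩ := reflTransGen_of_geodesic hX hJ h
  exact ⟨z, hz, mk_eq_mk.2 ⟨rfl, hxz⟩⟩

/-- A unit jump changes the integer part of the distance to `o` by at most one, and is itself an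
outer jump at the lower of the two levels. -/
theorem of_eq_or_parent_eq (hJ : 1 ≤ J) {x y : X} (hxy : dist x y ≤ 1)
    (hle : ⌊dist o x⌋₊ ≤ ⌊dist o y⌋₊) :
    of o J y = of o J x ∨ (of o J y).parent = of o J x := by
  have hx := Nat.floor_le (dist_nonneg (x := o) (y := x))
  have hy := Nat.floor_le (dist_nonneg (x := o) (y := y))
  have hstep : Relation.ReflTransGen (OuterJump o J ⌊dist o x⌋₊) y x :=
    .single ⟨(Nat.cast_le.2 hle).trans hy, hx, by rw [dist_comm]; exact hxy.trans hJ⟩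
  have hle' : ⌊dist o y⌋₊ ≤ ⌊dist o x⌋₊ + 1 := by
    rw [← Nat.floor_add_one dist_nonneg]
    exact Nat.floor_le_floor ((dist_triangle o x y).trans (by linarith))
  rcases hle.eq_or_lt with h | h
  · left
    exact mk_eq_mk.2 ⟨h.symm, h ▸ hstep⟩
  · right
    have h' : ⌊dist o y⌋₊ - 1 = ⌊dist o x⌋₊ := by omega
    rw [of, parent_mk]
    exact mk_eq_mk.2 ⟨h', h' ▸ hstep⟩

/-- The parent map transported to another type of vertices. -/
def parentAlong {V : Type v} (e : Cluster o J ≃ V) (a : V) : V := e (e.symm a).parent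

theorem iterate_parentAlong {V : Type v} (e : Cluster o J ≃ V) (i : ℕ) (c : Cluster o J) :
    (parentAlong e)^[i] (e c) = e (parent^[i] c) := by
  induction i with
  | zero => rfl
  | succ i ih => simp only [Function.iterate_succ_apply', ih, parentAlong, e.symm_apply_apply]

/-- The tree of clusters, on a given copy of the set of clusters. -/
abbrev tree (hX : IsGeodesicSpace X) (hJ : 1 ≤ J) {V : Type v} (e : Cluster o J ≃ V) :
    SimplicialTree.{v} where
  V := V
  graph := SimpleGraph.parentGraph (parentAlong e)
  isTree := SimpleGraph.parentGraph_isTree (fun a => (e.symm a).level) (e (root o J))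
    (fun a => by rw [level_eq_zero hX hJ, Equiv.symm_apply_eq])
    (fun a => by rw [parentAlong, e.symm_apply_apply, level_parent])

theorem dist_of_le_one (hJ : 1 ≤ J) {V : Type v} (e : Cluster o J ≃ V) {x y : X}
    (hxy : dist x y ≤ 1) :
    (SimpleGraph.parentGraph (parentAlong e)).dist (e (of o J x)) (e (of o J y)) ≤ 1 := by
  wlog hle : ⌊dist o x⌋₊ ≤ ⌊dist o y⌋₊ generalizing x y
  · rw [SimpleGraph.dist_comm]
    exact this (by rwa [dist_comm]) (Nat.le_of_not_le hle)
  rcases of_eq_or_parent_eq hJ hxy hle with h | h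
  · simp [h]
  · rw [SimpleGraph.dist_comm]
    exact SimpleGraph.parentGraph_dist_le_one (by rw [parentAlong, e.symm_apply_apply, h])

/-- Descend from `x` and `y` to the sphere at the level of the common ancestor. This costs at most
`i + 1` and `j + 1`, the extra units coming from the floors, and `Δ` bounds the gap on the sphere.
-/
theorem dist_le_of_iterate_parent_eq (hX : IsGeodesicSpace X) (hJ : 1 ≤ J) {Δ : ℝ}
    (hΔ : ∀ (k : ℕ) (x y : X), dist o x = k → dist o y = k →
      Relation.ReflTransGen (OuterJump o J k) x y → dist x y ≤ Δ) {x y : X} {i j : ℕ}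
    (h : parent^[i] (of o J x) = parent^[j] (of o J y)) : dist x y ≤ i + j + 2 + Δ := by
  have hx := Nat.floor_le (dist_nonneg (x := o) (y := x))
  have hy := Nat.floor_le (dist_nonneg (x := o) (y := y))
  rw [of, of, iterate_parent_mk, iterate_parent_mk, mk_eq_mk] at h
  obtain ⟨hk, h⟩ := h
  obtain ⟨x', hx0, hx1, hx2⟩ := reflTransGen_of_geodesic hX hJ (cast_sub_le hx i)
  obtain ⟨y', hy0, hy1, hy2⟩ := reflTransGen_of_geodesic hX hJ (cast_sub_le hy j)
  rw [← hk] at hy0 hy2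
  have hd := hΔ _ x' y' hx0 hy0 ((OuterJump.reflTransGen_symm hx2).trans (h.trans hy2))
  have h1 : dist o x - (⌊dist o x⌋₊ - i : ℕ) ≤ i + 1 := by
    have h2 := Nat.lt_floor_add_one (dist o x)
    have h3 : (⌊dist o x⌋₊ : ℝ) ≤ (⌊dist o x⌋₊ - i : ℕ) + i := by
      exact_mod_cast (by omega : ⌊dist o x⌋₊ ≤ (⌊dist o x⌋₊ - i) + i)
    linarith
  have h1' : dist o y - (⌊dist o y⌋₊ - j : ℕ) ≤ j + 1 := by
    have h2 := Nat.lt_floor_add_one (dist o y)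
    have h3 : (⌊dist o y⌋₊ : ℝ) ≤ (⌊dist o y⌋₊ - j : ℕ) + j := by
      exact_mod_cast (by omega : ⌊dist o y⌋₊ ≤ (⌊dist o y⌋₊ - j) + j)
    linarith
  have h4 := dist_triangle4 x x' y' y
  rw [dist_comm y' y] at h4
  linarith

/-- If clusters are uniformly bounded, then the tree of clusters is at bounded distance from the
space, without multiplicative distortion. -/
theorem quasiIsometricTo_tree (hX : IsGeodesicSpace X) (hJ : 1 ≤ J) {Δ : ℝ} (hΔ0 : 0 ≤ Δ)
    (hΔ : ∀ (k : ℕ) (x y : X), dist o x = k → dist o y = k →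
      Relation.ReflTransGen (OuterJump o J k) x y → dist x y ≤ Δ) {V : Type v}
    (e : Cluster o J ≃ V) : QuasiIsometricTo 1 (Δ + 2) X (tree hX hJ e).Space := by
  refine ⟨fun x => (tree hX hJ e).vertex (e (of o J x)), ⟨fun x y => ?_, fun x y => ?_,
    fun p => ?_⟩⟩
  · rw [SimplicialTree.dist_vertex]
    obtain ⟨w, hw⟩ := (tree hX hJ e).isTree.connected.exists_walk_length_eq_dist
      (e (of o J x)) (e (of o J y))
    obtain ⟨i, j, hij, hl⟩ := SimpleGraph.exists_iterate_eq_of_parentGraph_walk w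
    rw [iterate_parentAlong, iterate_parentAlong, e.apply_eq_iff_eq] at hij
    have h1 := dist_le_of_iterate_parent_eq hX hJ hΔ hij
    rw [hw] at hl
    have h2 : (i : ℝ) + j ≤ (tree hX hJ e).graph.dist (e (of o J x)) (e (of o J y)) := by
      exact_mod_cast hl
    linarith
  · rw [SimplicialTree.dist_vertex]
    obtain ⟨p, h0, h1, h, -⟩ := hX.exists_chain x y
    have key : ∀ i, (tree hX hJ e).graph.dist (e (of o J x)) (e (of o J (p i))) ≤ i := by
      intro i
      induction i with
      | zero => simp [h0]
      | succ i ih =>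
        exact (tree hX hJ e).isTree.connected.dist_triangle.trans
          (add_le_add ih (dist_of_le_one hJ e (h i)))
    have h2 := key ⌈dist x y⌉₊
    rw [h1] at h2
    have h3 := Nat.ceil_lt_add_one (dist_nonneg (x := x) (y := y))
    have h4 : ((tree hX hJ e).graph.dist (e (of o J x)) (e (of o J y)) : ℝ) ≤ ⌈dist x y⌉₊ := by
      exact_mod_cast h2
    linarith
  · obtain ⟨a, ha⟩ := SimplicialTree.exists_dist_vertex_le_one p
    -- A representative at distance exactly the level from `o` is mapped to the vertex itself.
    obtain ⟨x, hx, hc⟩ := exists_eq_mk_level hX hJ (e.symm a)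
    refine ⟨x, ?_⟩
    have h1 : e (of o J x) = a := by
      rw [← Equiv.eq_symm_apply, hc]
      exact mk_eq_mk.2 ⟨by rw [hx, Nat.floor_natCast], .refl⟩
    rw [h1, dist_comm]
    linarith

end Cluster

end Cluster
-- Bounding clusters by means of the original tree.
section CoarseTree

variable {X : Type u} [MetricSpace X]

theorem QuasiIsometricTo.exists_vertex_map {L C : ℝ} (hL : 1 ≤ L) (hC : 0 ≤ C)
    {T : SimplicialTree.{v}} (h : QuasiIsometricTo L C X T.Space) :
    ∃ g : X → T.V, ∃ B : ℝ, 0 ≤ B ∧ ∀ x y, (T.graph.dist (g x) (g y) : ℝ) ≤ L * dist x y + B ∧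
      dist x y ≤ L * T.graph.dist (g x) (g y) + B := by
  obtain ⟨f, hf⟩ := h
  choose g hg using fun x => SimplicialTree.exists_dist_vertex_le_one (f x)
  -- Moving both images to vertices costs `2` beyond `C`; the factor `L` appears on clearing `1 / L`
  -- in the lower bound.
  refine ⟨g, L * (C + 2), by positivity, fun x y => ?_⟩
  rw [← SimplicialTree.dist_vertex]
  have h1 := dist_triangle4 (f x) (T.vertex (g x)) (T.vertex (g y)) (f y)
  have h2 := dist_triangle4 (T.vertex (g x)) (f x) (f y) (T.vertex (g y))
  rw [dist_comm (T.vertex (g y)) (f y)] at h1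
  rw [dist_comm (T.vertex (g x)) (f x)] at h2
  have h3 := hg x
  have h4 := hg y
  have h5 := hf.upper x y
  have h6 := hf.lower x y
  constructor
  · nlinarith
  · have h7 : 1 / L * dist x y ≤ dist (T.vertex (g x)) (T.vertex (g y)) + (C + 2) := by linarith
    rw [one_div, inv_mul_le_iff₀ (by linarith)] at h7
    linarith

/-- In a geodesic space that maps coarsely to a tree, clusters are uniformly bounded. -/
theorem IsGeodesicSpace.exists_cluster_bound (hX : IsGeodesicSpace X) (o : X) {V : Type v}
    {G : SimpleGraph V} (hG : G.IsTree) (g : X → V) {A B : ℝ} (hA : 0 ≤ A) (hB : 0 ≤ B)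
    (hg : ∀ x y, (G.dist (g x) (g y) : ℝ) ≤ A * dist x y + B ∧
      dist x y ≤ A * G.dist (g x) (g y) + B) {J : ℝ} (hJ : 1 ≤ J) :
    ∃ Δ : ℝ, 0 ≤ Δ ∧ ∀ (k : ℕ) (x y : X), dist o x = k → dist o y = k →
      Relation.ReflTransGen (OuterJump o J k) x y → dist x y ≤ Δ := by
  obtain ⟨E, hE⟩ := exists_nat_ge (A * J + B)
  have hjump : ∀ a b, dist a b ≤ J → G.dist (g a) (g b) ≤ E := by
    intro a b hab
    have h1 := (hg a b).1
    have h2 := mul_le_mul_of_nonneg_left hab hA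
    have : (G.dist (g a) (g b) : ℝ) ≤ E := by linarith
    exact_mod_cast this
  have hnear : ∀ a b s t, G.dist (g a) s ≤ E → G.dist (g b) t ≤ E → G.dist s t ≤ 1 →
      dist a b ≤ A * (2 * E + 1) + B := by
    intro a b s t ha hb hst
    have h1 := hG.connected.dist_triangle (u := g a) (v := s) (w := g b)
    have h2 := hG.connected.dist_triangle (u := s) (v := t) (w := g b)
    rw [G.dist_comm (u := t)] at h2
    have h3 : (G.dist (g a) (g b) : ℝ) ≤ 2 * E + 1 := by
      exact_mod_cast (by omega : G.dist (g a) (g b) ≤ 2 * E + 1)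
    have h4 := mul_le_mul_of_nonneg_left h3 hA
    linarith [(hg a b).2]
  have hgeod : ∀ x, ∃ w : G.Walk (g x) (g o), ∀ m ∈ w.support,
      ∃ p, dist x p + dist p o = dist x o ∧ G.dist (g p) m ≤ E := by
    intro x
    obtain ⟨w, hw⟩ := hG.connected.exists_walk_near_chain g
      (fun a b h => hjump a b (h.1.trans hJ)) (hX.reflTransGen x o)
    refine ⟨w, fun m hm => ?_⟩
    obtain ⟨p, hp, hd⟩ := hw m hm
    refine ⟨p, ?_, hd⟩
    cases hp with
    | refl => simp
    | tail _ h => exact h.2.2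
  -- Put `K = A(2E+1) + B`. Since `z` is within `K` of `p` and `d(o,z) ≥ k`, also `d(x,p) = k -
  -- d(o,p) ≤ K`, so `d(x,z) ≤ 2K`. The same holds for `y` and `q`.
  refine ⟨4 * (A * (2 * E + 1) + B), by positivity, fun k x y hx hy hxy => ?_⟩
  obtain ⟨w₁, hw₁⟩ := hG.connected.exists_walk_near_chain g (fun a b h => hjump a b h.2.2) hxy
  obtain ⟨w₂, hw₂⟩ := hgeod x
  obtain ⟨w₃, hw₃⟩ := hgeod y
  obtain ⟨s, t, hs₁, hs₂, ht, hst⟩ := hG.exists_coarse_median w₁ w₂ w₃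
  obtain ⟨z, hxz, hz⟩ := hw₁ s hs₁
  obtain ⟨p, hxp, hp⟩ := hw₂ s hs₂
  obtain ⟨q, hyq, hq⟩ := hw₃ t ht
  have hk := OuterJump.le_of_reflTransGen hx.ge hxz
  have hzp := hnear z p s s hz hp (by simp)
  have hzq := hnear z q s t hz hq hst
  have h1 := dist_triangle o p z
  have h2 := dist_triangle o q z
  have h3 := dist_triangle4 x p z y
  have h4 := dist_triangle z q y
  rw [dist_comm x o, dist_comm p o] at hxp
  rw [dist_comm y o, dist_comm q o] at hyq
  rw [dist_comm p z] at h1 h3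
  rw [dist_comm q z] at h2
  rw [dist_comm q y] at h4
  linarith

end CoarseTree

/-! ### Size of the cluster tree, and conclusion. -/

/-- A geodesic space that is quasi-isometric to a tree is quasi-isometric, without multiplicative
distortion, to a tree whose vertices are controlled by their level and a vertex of the first
tree. -/
theorem QuasiIsometricTo.exists_tree {X : Type u} [MetricSpace X] (hX : IsGeodesicSpace X)
    {L C : ℝ} (hL : 1 ≤ L) (hC : 0 ≤ C) {T : SimplicialTree.{v}}
    (h : QuasiIsometricTo L C X T.Space) :
    ∃ C' : ℝ, 0 ≤ C' ∧ ∃ T' : SimplicialTree.{v}, QuasiIsometricTo 1 C' X T'.Space ∧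
      (T.IsCountable → T'.IsCountable) ∧ (T.IsLocallyFinite → T'.IsLocallyFinite) := by
  obtain ⟨o⟩ : Nonempty X := by
    obtain ⟨f, hf⟩ := h
    obtain ⟨a⟩ := T.isTree.connected.nonempty
    exact ⟨(hf.coarsely_surjective (T.vertex a)).choose⟩
  obtain ⟨g, B, hB, hg⟩ := h.exists_vertex_map hL hC
  -- Points with the same image under `g` are within `B`, so a jump of length `B + 1` links them;
  -- this makes `ψ` injective.
  have hJ : 1 ≤ B + 1 := by linarith
  obtain ⟨Δ, hΔ0, hΔ⟩ := hX.exists_cluster_bound o T.isTree g (by linarith) hB hg hJ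
  choose r hr hrc using Cluster.exists_eq_mk_level (o := o) hX hJ
  let ψ : Cluster o (B + 1) → ℕ × T.V := fun c => (c.level, g (r c))
  have hψ : Function.Injective ψ := by
    intro c d hcd
    obtain ⟨hl, hgr⟩ := Prod.mk.inj hcd
    rw [hrc c, hrc d, Cluster.mk_eq_mk]
    refine ⟨hl, .single ⟨(hr c).ge, by rw [hl]; exact (hr d).ge, ?_⟩⟩
    have h1 := (hg (r c) (r d)).2
    rw [hgr, SimpleGraph.dist_self] at h1
    simp only [Nat.cast_zero, mul_zero, zero_add] at h1
    linarith
  -- Clusters live in the universe of `X`; the injection `ψ` allows a copy in that of `T`.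
  have : Small.{v} (Cluster o (B + 1)) := small_of_injective hψ
  let e := equivShrink.{v} (Cluster o (B + 1))
  refine ⟨Δ + 2, by linarith, Cluster.tree hX hJ e,
    Cluster.quasiIsometricTo_tree hX hJ hΔ0 hΔ e, fun hT => ?_, fun hT a => ?_⟩
  · have : Countable T.V := hT
    exact (hψ.comp e.symm.injective).countable
  · obtain ⟨N, hN⟩ := exists_nat_ge (L * ((e.symm a).level + 1 : ℕ) + B)
    have hfin := ((Set.finite_Iic ((e.symm a).level + 1)).prod
      (T.isTree.connected.finite_ball hT (g o) N)).preimage (hψ.comp e.symm.injective).injOn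
    refine hfin.subset fun b hb => ?_
    have hlev : (e.symm b).level ≤ (e.symm a).level + 1 := by
      obtain ⟨-, h | h⟩ := SimpleGraph.parentGraph_adj.1 hb
      · have h1 : (e.symm b).level = (e.symm a).level - 1 := by
          rw [← h, Cluster.parentAlong, e.symm_apply_apply, Cluster.level_parent]
        omega
      · have h1 : (e.symm a).level = (e.symm b).level - 1 := by
          rw [← h, Cluster.parentAlong, e.symm_apply_apply, Cluster.level_parent]
        omega
    refine ⟨hlev, ?_⟩
    have h1 := (hg o (r (e.symm b))).1
    rw [hr] at h1
    have h2 : ((e.symm b).level : ℝ) ≤ ((e.symm a).level + 1 : ℕ) := Nat.cast_le.2 hlev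
    have h3 := mul_le_mul_of_nonneg_left h2 (by linarith : 0 ≤ L)
    have h4 : (T.graph.dist (g o) (g (r (e.symm b))) : ℝ) ≤ N := by linarith
    exact_mod_cast h4

theorem mainTheorem8 (X : Type u) [MetricSpace X] (hX : IsGeodesicSpace X) :
    ((∃ L C : ℝ, 1 ≤ L ∧ 0 ≤ C ∧
        ∃ T : SimplicialTree.{v}, T.IsCountable ∧ QuasiIsometricTo L C X T.Space) ↔
      ∃ C' : ℝ, 0 ≤ C' ∧
        ∃ T : SimplicialTree.{v}, T.IsCountable ∧ QuasiIsometricTo 1 C' X T.Space) ∧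
    ((∃ L C : ℝ, 1 ≤ L ∧ 0 ≤ C ∧
        ∃ T : SimplicialTree.{v}, T.IsLocallyFinite ∧ QuasiIsometricTo L C X T.Space) ↔
      ∃ C' : ℝ, 0 ≤ C' ∧
        ∃ T : SimplicialTree.{v}, T.IsLocallyFinite ∧ QuasiIsometricTo 1 C' X T.Space) := by
  constructor
  · constructor
    · rintro ⟨L, C, hL, hC, T, hT, h⟩
      obtain ⟨C', hC', T', h', hc, -⟩ := h.exists_tree hX hL hC
      exact ⟨C', hC', T', hc hT, h'⟩
    · rintro ⟨C', hC', T, hT, h⟩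
      exact ⟨1, C', le_rfl, hC', T, hT, h⟩
  · constructor
    · rintro ⟨L, C, hL, hC, T, hT, h⟩
      obtain ⟨C', hC', T', h', -, hf⟩ := h.exists_tree hX hL hC
      exact ⟨C', hC', T', hf hT, h'⟩
    · rintro ⟨C', hC', T, hT, h⟩
      exact ⟨1, C', le_rfl, hC', T, hT, h⟩
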